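/- Consider a synchronous system of $n>1$ processes, connected by a complete graph of reliable channels, in which at most $f\ge 0$ processes are Byzantine faulty, that is, may send arbitrary messages (different ones to different receivers). Each process has an input vector in $\mathbb{R}^d$, where $d\ge 1$. In each round every process sends a (possibly empty) message to every process and then updates its state from the messages received; non-faulty processes follow a deterministic algorithm, with unbounded state and message spaces. The algorithm solves exact Byzantine vector consensus if, for every set of at most $f$ faulty processes, all inputs and every behavior of the faulty processes, the following hold: (Agreement) the decision vectors of all non-faulty processes are identical; (Validity) the decision vector of each non-faulty process lies in the convex hull of the input vectors of the non-faulty processes; (Termination) each non-faulty process decides after finitely many rounds. If some algorithm solves exact Byzantine vector consensus in this system, then $$n\ \ge\ \max\bigl(3f+1,\ (d+1)f+1\bigr).$$ -/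

import Mathlib

universe u v

/-- A deterministic algorithm for `n` processes on a complete graph, running in synchronous
lock-step rounds, with inputs and decisions in `ℝ^d`. Every process has its own start, message,
transition and output functions. State and message spaces are arbitrary, so that there is no bound
on local memory, on local computation or on the length of a message. -/
structure SyncAlgorithm (n d : ℕ) where
  /-- local states -/
  State : Type u
  /-- messages; `none : Option Message` means that nothing is sent on a channel in a round -/
  Message : Type v
  /-- `init i x` is the start state of process `i` with input vector `x` -/
  init : Fin n → EuclideanSpace ℝ (Fin d) → State
  /-- `send i s j` is what process `i`, in state `s`, sends to process `j` -/
  send : Fin n → State → Fin n → Option Message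
  /-- `step i s r` is the next state of process `i`, in state `s`, when it receives `r j` from
  each process `j` in the current round -/
  step : Fin n → State → (Fin n → Option Message) → State
  /-- the output register of process `i` in a given state; `none` means: not yet decided -/
  output : Fin n → State → Option (EuclideanSpace ℝ (Fin d))

namespace SyncAlgorithm

variable {n d : ℕ} (A : SyncAlgorithm.{u, v} n d)

/-- The state of each process after `t` rounds of the execution in which the set of faulty
processes is `F`, the inputs are `x`, and, in round `t`, the faulty process `j` sends `byz t j i` to
process `i`. The faulty processes are unrestricted: `byz` is arbitrary, and may send
different things to different receivers. Channels are reliable. The states listed for the members of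
`F` have no meaning and influence no other process. -/
def state {n d : ℕ} (A : SyncAlgorithm.{u, v} n d) (F : Finset (Fin n)) (x : Fin n → EuclideanSpace ℝ (Fin d))
    (byz : ℕ → Fin n → Fin n → Option A.Message) : ℕ → Fin n → A.State
  | 0, i => A.init i (x i)
  | t + 1, i => A.step i (state A F x byz t i) fun j =>
      if j ∈ F then byz t j i else A.send j (state A F x byz t j) i

/-- In this execution process `i` decides on `y`: the first value that appears in its output
register, after finitely many rounds, is `y`. -/
def Decides (F : Finset (Fin n)) (x : Fin n → EuclideanSpace ℝ (Fin d))
    (byz : ℕ → Fin n → Fin n → Option A.Message) (i : Fin n)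
    (y : EuclideanSpace ℝ (Fin d)) : Prop :=
  ∃ t : ℕ, A.output i (A.state F x byz t i) = some y ∧
    ∀ s < t, A.output i (A.state F x byz s i) = none

/-- Agreement: the decision vectors of the non-faulty processes are identical. -/
def Agreement (F : Finset (Fin n)) (x : Fin n → EuclideanSpace ℝ (Fin d))
    (byz : ℕ → Fin n → Fin n → Option A.Message) : Prop :=
  ∀ i ∉ F, ∀ j ∉ F, ∀ y z, A.Decides F x byz i y → A.Decides F x byz j z → y = z

/-- Validity: the decision vector of each non-faulty process is in the convex hull of the inputs
of the non-faulty processes. -/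
def Validity (F : Finset (Fin n)) (x : Fin n → EuclideanSpace ℝ (Fin d))
    (byz : ℕ → Fin n → Fin n → Option A.Message) : Prop :=
  ∀ i ∉ F, ∀ y, A.Decides F x byz i y → y ∈ convexHull ℝ (x '' {j | j ∉ F})

/-- Termination: each non-faulty process decides after finitely many rounds. -/
def Termination (F : Finset (Fin n)) (x : Fin n → EuclideanSpace ℝ (Fin d))
    (byz : ℕ → Fin n → Fin n → Option A.Message) : Prop :=
  ∀ i ∉ F, ∃ y, A.Decides F x byz i y

/-- The algorithm achieves exact Byzantine vector consensus in presence of up to `f` faulty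
processes: the three conditions hold in every execution with at most `f` faulty processes. -/
def SolvesExactBVC (f : ℕ) : Prop :=
  ∀ F : Finset (Fin n), F.card ≤ f → ∀ (x : Fin n → EuclideanSpace ℝ (Fin d))
    (byz : ℕ → Fin n → Fin n → Option A.Message),
    A.Agreement F x byz ∧ A.Validity F x byz ∧ A.Termination F x byz

end SyncAlgorithm

/-!
Both bounds are indistinguishability arguments in a *covering system*: every process `i` is
replaced by copies `(i, k)` running the code of `i`, where `(i, k)` listens to the copy
`σ i j k` of process `j`. A faulty set `F` can simulate all copies of its members, and so if
`c i` selects one copy of each process, such that the selected copies outside `F` listen to one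
another, then these copies behave as in an execution of the real system with faulty set `F`.
Consensus therefore holds among them (`CoverDecides.exists_of_solves`). The processes are divided
into residue classes modulo `m`, which have at most `f` members if `n ≤ m * f`.

* For `(d + 1) * f < n`, there is a single copy, that is, all processes behave correctly. The class
  of `r` has as input the vertex `r` of the simplex with vertices `0, e₁, …, e_d`. A process
  outside a given class cannot rule out that this class is faulty, so that the decision is in
  the facet opposite to the vertex of this class. Processes `0` and `1` are in different
  classes and agree, so their decision is in all facets, whose intersection is empty.
* For `3 * f < n`, there are two copies, with inputs `0` and `v ≠ 0`, and the classes modulo `3`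
  form the hexagon `0, 1, 2, 0', 1', 2'`. In it, the adjacent classes `1, 2` decide
  `0`, the adjacent classes `0', 1'` decide `v`, and the adjacent classes `2, 0'` agree.
-/

namespace SyncAlgorithm

variable {n d : ℕ} (A : SyncAlgorithm.{u, v} n d) {κ : Type*}

/-! ### Covering systems -/

/-- The state of the copy `(i, k)` after `t` rounds in the covering system in which `(i, k)` has
input `x i k` and receives from process `j` what its copy `(j, σ i j k)` sends to `i`. -/
def coverState (σ : Fin n → Fin n → κ → κ) (x : Fin n → κ → EuclideanSpace ℝ (Fin d)) :
    ℕ → Fin n → κ → A.State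
  | 0, i, k => A.init i (x i k)
  | t + 1, i, k => A.step i (coverState σ x t i k) fun j =>
      A.send j (coverState σ x t j (σ i j k)) i

/-- In the covering system, the first value in the output register of the copy `(i, k)` is `y`. -/
def CoverDecides (σ : Fin n → Fin n → κ → κ) (x : Fin n → κ → EuclideanSpace ℝ (Fin d))
    (i : Fin n) (k : κ) (y : EuclideanSpace ℝ (Fin d)) : Prop :=
  ∃ t : ℕ, A.output i (A.coverState σ x t i k) = some y ∧
    ∀ s < t, A.output i (A.coverState σ x s i k) = none

variable {A} {σ : Fin n → Fin n → κ → κ} {x : Fin n → κ → EuclideanSpace ℝ (Fin d)}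

theorem CoverDecides.unique {i : Fin n} {k : κ} {y z : EuclideanSpace ℝ (Fin d)}
    (hy : A.CoverDecides σ x i k y) (hz : A.CoverDecides σ x i k z) : y = z := by
  obtain ⟨t, hty, ht⟩ := hy
  obtain ⟨s, hsz, hs⟩ := hz
  rcases lt_trichotomy t s with h | rfl | h
  · simp [hs t h] at hty
  · exact Option.some.inj (hty.symm.trans hsz)
  · simp [ht s h] at hsz

variable (A) in
/-- If the copies selected by `c` listen to one another outside `F`, then they run as
the non-faulty processes of the execution in which the members of `F` simulate all their copies. -/
theorem state_eq_coverState (F : Finset (Fin n)) (c : Fin n → κ)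
    (hc : ∀ i ∉ F, ∀ j ∉ F, σ i j (c i) = c j) (t : ℕ) :
    ∀ i ∉ F, A.state F (fun i => x i (c i))
      (fun t j i => A.send j (A.coverState σ x t j (σ i j (c i))) i) t i =
        A.coverState σ x t i (c i) := by
  induction t with
  | zero => intro i _; rfl
  | succ t ih =>
    intro i hi
    simp only [state, coverState, ih i hi]
    congr 1
    funext j
    split_ifs with hj
    · rfl
    · rw [ih j hj, hc i hi j hj]

/-- Consensus among those copies of a covering system that run as the non-faulty processes of
some execution. -/
theorem CoverDecides.exists_of_solves {f : ℕ} (hA : A.SolvesExactBVC f)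
    {F : Finset (Fin n)} (hF : F.card ≤ f) {c : Fin n → κ}
    (hc : ∀ i ∉ F, ∀ j ∉ F, σ i j (c i) = c j) {i : Fin n} (hi : i ∉ F) :
    ∃ y ∈ convexHull ℝ ((fun j => x j (c j)) '' {j | j ∉ F}),
      ∀ j ∉ F, A.CoverDecides σ x j (c j) y := by
  obtain ⟨agree, valid, term⟩ := hA F hF (fun i => x i (c i))
    (fun t j i => A.send j (A.coverState σ x t j (σ i j (c i))) i)
  obtain ⟨y, hy⟩ := term i hi
  refine ⟨y, valid i hi y hy, fun j hj => ?_⟩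
  obtain ⟨z, hz⟩ := term j hj
  obtain rfl := agree i hi j hj y z hy hz
  obtain ⟨t, ht, hs⟩ := hz
  refine ⟨t, ?_, fun s hst => ?_⟩
  · rw [← A.state_eq_coverState F c hc t j hj, ht]
  · rw [← A.state_eq_coverState F c hc s j hj, hs s hst]

/-! ### Residue classes of processes -/

/-- The processes whose index is congruent to `r` modulo `m`, for `r < m`. -/
def residueClass (n m r : ℕ) : Finset (Fin n) :=
  Finset.univ.filter fun i => (i : ℕ) % m = r

theorem mem_residueClass {n m r : ℕ} {i : Fin n} :
    i ∈ residueClass n m r ↔ (i : ℕ) % m = r := by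
  simp [residueClass]

theorem card_residueClass_le {n m f : ℕ} (h : n ≤ m * f) (r : ℕ) :
    (residueClass n m r).card ≤ f := by
  rw [← Finset.card_range f]
  refine Finset.card_le_card_of_injOn (fun i => (i : ℕ) / m) (fun i _ => ?_) ?_
  · simpa using Nat.div_lt_of_lt_mul (i.isLt.trans_le h)
  · intro i hi j hj hij
    rw [Finset.mem_coe, mem_residueClass] at hi hj
    have hij : (i : ℕ) / m = (j : ℕ) / m := hij
    apply Fin.ext
    rw [← Nat.div_add_mod (i : ℕ) m, ← Nat.div_add_mod (j : ℕ) m, hi, hj, hij]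

/-! ### The bound depending on the dimension -/

/-- The vertices of the simplex spanned by the standard basis vectors and the origin; vertex `r` is
the `r`-th (from `0`) basis vector for `r < d`, and the origin for `r ≥ d`. -/
noncomputable def simplexVertex (d r : ℕ) : EuclideanSpace ℝ (Fin d) :=
  WithLp.toLp 2 fun k => if (k : ℕ) = r then 1 else 0

/-- The facets of the simplex have no common point: the points of the facet opposite to `e_r` have
`r`-th coordinate `0`, and those of the facet opposite to the origin have coordinate sum `1`. -/
theorem not_forall_mem_facet (d : ℕ) (y : EuclideanSpace ℝ (Fin d)) :
    ¬ ∀ r ≤ d, y ∈ convexHull ℝ (simplexVertex d '' {s | s ≤ d ∧ s ≠ r}) := by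
  intro h
  have hcoord (k : Fin d) : y k = 0 := by
    have hconv : Convex ℝ {z : EuclideanSpace ℝ (Fin d) | z k = 0} := by
      intro a ha b hb p q _ _ _
      simp_all
    refine convexHull_min ?_ hconv (h k k.isLt.le)
    rintro _ ⟨s, ⟨_, hs⟩, rfl⟩
    simp [simplexVertex, hs.symm]
  have hsum : ∑ k, y k = 1 := by
    have hconv : Convex ℝ {z : EuclideanSpace ℝ (Fin d) | ∑ k, z k = 1} := by
      intro a ha b hb p q _ _ hpq
      simp only [Set.mem_ofPred_eq] at ha hb ⊢
      simp [Finset.sum_add_distrib, ← Finset.mul_sum, ha, hb, hpq]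
    refine convexHull_min ?_ hconv (h d le_rfl)
    rintro _ ⟨s, ⟨hs, hsd⟩, rfl⟩
    have hlt : s < d := lt_of_le_of_ne hs hsd
    have heq (k : Fin d) : (k : ℕ) = s ↔ k = ⟨s, hlt⟩ := by
      simp [Fin.ext_iff]
    simp [simplexVertex, heq]
  simp [hcoord] at hsum

theorem SolvesExactBVC.dim_succ_mul_lt {f : ℕ} (hA : A.SolvesExactBVC f) (hn : 1 < n)
    (hd : 0 < d) : (d + 1) * f < n := by
  by_contra! hnf
  let x : Fin n → Unit → EuclideanSpace ℝ (Fin d) :=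
    fun i _ => simplexVertex d ((i : ℕ) % (d + 1))
  let σ : Fin n → Fin n → Unit → Unit := fun _ _ k => k
  let p₀ : Fin n := ⟨0, by omega⟩
  let p₁ : Fin n := ⟨1, hn⟩
  have hp₀ : (p₀ : ℕ) % (d + 1) = 0 := Nat.zero_mod _
  have hp₁ : (p₁ : ℕ) % (d + 1) = 1 := Nat.mod_eq_of_lt (show 1 < d + 1 by omega)
  have key (r : ℕ) {i : Fin n} (hi : (i : ℕ) % (d + 1) ≠ r) :
      ∃ y ∈ convexHull ℝ (simplexVertex d '' {s | s ≤ d ∧ s ≠ r}),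
        ∀ j : Fin n, (j : ℕ) % (d + 1) ≠ r → A.CoverDecides σ x j () y := by
    obtain ⟨y, hy, hdec⟩ := CoverDecides.exists_of_solves (x := x) (σ := σ) (c := fun _ => ()) hA
      (card_residueClass_le hnf r) (fun _ _ _ _ => rfl) (mt mem_residueClass.1 hi)
    refine ⟨y, convexHull_mono ?_ hy, fun j hj => hdec j (mt mem_residueClass.1 hj)⟩
    rintro _ ⟨j, hj, rfl⟩
    exact ⟨_, ⟨Nat.lt_succ_iff.1 (Nat.mod_lt _ d.succ_pos), mt mem_residueClass.2 hj⟩, rfl⟩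
  -- The execution without faults shows that the two processes have the same decision.
  obtain ⟨y, -, hy⟩ := CoverDecides.exists_of_solves (x := x) (σ := σ) (c := fun _ => ()) hA
    (F := ∅) (by simp) (fun _ _ _ _ => rfl) (Finset.notMem_empty p₀)
  refine not_forall_mem_facet d y fun r _ => ?_
  obtain ⟨i, hi⟩ : ∃ i : Fin n, (i : ℕ) % (d + 1) ≠ r := by
    by_cases hr : r = 0
    · exact ⟨p₁, by omega⟩
    · exact ⟨p₀, by omega⟩
  obtain ⟨z, hz, hdec⟩ := key r hi
  rwa [(hy i (Finset.notMem_empty i)).unique (hdec i hi)]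

/-! ### The bound independent of the dimension -/

theorem SolvesExactBVC.three_mul_lt {f : ℕ} (hA : A.SolvesExactBVC f) (hn : 2 < n)
    (hd : 0 < d) : 3 * f < n := by
  by_contra! hnf
  have : Nonempty (Fin d) := ⟨⟨0, hd⟩⟩
  obtain ⟨v, hv⟩ := exists_ne (0 : EuclideanSpace ℝ (Fin d))
  let x : Fin n → Bool → EuclideanSpace ℝ (Fin d) := fun _ b => if b then v else 0
  -- Exactly the links between the classes `0` and `2` lead from one copy to the other.
  let σ : Fin n → Fin n → Bool → Bool := fun i j b =>
    if ((i : ℕ) % 3 = 0 ∧ (j : ℕ) % 3 = 2) ∨ ((i : ℕ) % 3 = 2 ∧ (j : ℕ) % 3 = 0) then !b else b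
  let p₀ : Fin n := ⟨0, by omega⟩
  let p₂ : Fin n := ⟨2, hn⟩
  have hp₀ (r : ℕ) (hr : r ≠ 0) : p₀ ∉ residueClass n 3 r := by
    rw [mem_residueClass]; exact hr.symm
  have hp₂ (r : ℕ) (hr : r ≠ 2) : p₂ ∉ residueClass n 3 r := by
    rw [mem_residueClass]; exact hr.symm
  -- If all inputs are equal, then validity determines the decision.
  have same (b : Bool) (r : ℕ) (hr : r = 0 ∨ r = 2) {i : Fin n} (hi : i ∉ residueClass n 3 r) :
      A.CoverDecides σ x i b (if b then v else 0) := by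
    obtain ⟨y, hy, hdec⟩ := CoverDecides.exists_of_solves (x := x) (σ := σ) (c := fun _ => b) hA
      (card_residueClass_le hnf r) (fun i hi j hj => by
        rw [mem_residueClass] at hi hj
        exact if_neg (by omega)) hi
    have hsub : (fun j => x j b) '' {j | j ∉ residueClass n 3 r} ⊆ {if b then v else 0} := by
      rintro _ ⟨j, _, rfl⟩
      rfl
    have hy' := convexHull_min hsub (convex_singleton _) hy
    rw [Set.mem_singleton_iff] at hy'
    exact hy' ▸ hdec i hi
  have h₂ : A.CoverDecides σ x p₂ false 0 := same false 0 (.inl rfl) (hp₂ 0 (by omega))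
  have h₀ : A.CoverDecides σ x p₀ true v := same true 2 (.inr rfl) (hp₀ 2 (by omega))
  obtain ⟨y, -, hdec⟩ := CoverDecides.exists_of_solves (x := x) (σ := σ)
    (c := fun i => decide ((i : ℕ) % 3 = 0)) hA (card_residueClass_le hnf 1)
    (fun i hi j hj => by
      rw [mem_residueClass] at hi hj
      have hi' : (i : ℕ) % 3 = 0 ∨ (i : ℕ) % 3 = 2 := by omega
      have hj' : (j : ℕ) % 3 = 0 ∨ (j : ℕ) % 3 = 2 := by omega
      rcases hi' with hi' | hi' <;> rcases hj' with hj' | hj' <;> simp [σ, hi', hj'])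
    (hp₀ 1 (by omega))
  have hy₀ : y = v := (hdec p₀ (hp₀ 1 (by omega))).unique h₀
  have hy₂ : y = 0 := (hdec p₂ (hp₂ 1 (by omega))).unique h₂
  exact hv (hy₀.symm.trans hy₂)

end SyncAlgorithm

theorem theorem1 (n d f : ℕ) (hn : 1 < n) (hd : 0 < d)
    (A : SyncAlgorithm.{u, v} n d) (hA : A.SolvesExactBVC f) :
    max (3 * f + 1) ((d + 1) * f + 1) ≤ n := by
  have hdim := hA.dim_succ_mul_lt hn hd
  refine max_le ?_ hdim
  rcases Nat.eq_zero_or_pos f with rfl | hf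
  · omega
  · -- The hexagon needs three nonempty classes; two processes are excluded by the other bound.
    have h2 : 2 * 1 ≤ (d + 1) * f := Nat.mul_le_mul (by omega) hf
    exact hA.three_mul_lt (by omega) hd
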